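/- Let $l\ge 1$ and $n,m\ge 2$ be integers, $N=(1,\dots,1,n,m)$ (with $l$ ones) and $|N|=l+n+m$. Write points of $\mathbb C^{|N|+2}$ as $\Theta=(\xi,\zeta,\eta)\in\mathbb C^l\times\mathbb C^{n+1}\times\mathbb C^{m+1}$, let $|\cdot|$ be the Euclidean norm and put $z\bullet z=\sum_j z_j^2$. Let $$\mathbb H_N=\{(\xi,\zeta,\eta):\ \zeta\ne0,\ \eta\neq0,\ \zeta\bullet\zeta=\eta\bullet\eta=0\},\qquad \mathbb M_N=\mathbb H_N\cap\{|\Theta|<1\},\qquad \partial\mathbb M_N=\mathbb H_N\cap\{|\Theta|=1\}.$$ Let $dV$ be the canonical (Riemannian) volume measure of the complex manifold $\mathbb H_N$, of real dimension $2|N|$, and let $d\sigma$ be the surface measure of $\partial\mathbb M_N$, of real dimension $2|N|-1$, both induced by the Euclidean metric of $\mathbb C^{|N|+2}$. Let $\mathcal C^1(\overline{\mathbb M}_N)$ be the space of complex-valued functions of class $\mathcal C^1$ on a relatively open neighbourhood, in the closed unit ball, of the closure $\overline{\mathbb M}_N$ of $\mathbb M_N$. For a function $u$ that is differentiable at $\Theta$,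 $|\mathrm{grad}_\zeta u|$ denotes the Euclidean norm of the gradient in the variables $\zeta$, that is $|\mathrm{grad}_\zeta u|^2=\sum_j\big(|\partial u/\partial \mathrm{Re}\,\zeta_j|^2+|\partial u/\partial \mathrm{Im}\,\zeta_j|^2\big)$, and $|\mathrm{grad}_\xi u|$, $|\mathrm{grad}_\eta u|$ are defined in the same way. **Theorem 9.1.** There is a constant $C=C(N)>0$ such that, for every $v\in\mathcal C^1(\overline{\mathbb M}_N)$ and all real numbers $\lambda<2n-1$ and $\mu<2m-1$, the function $u(\Theta)=\dfrac{v(\Theta)}{|\zeta|^{\lambda}|\eta|^{\mu}}$ satisfies $$\left|\int_{\partial\mathbb M_N}u\,d\sigma\right|\le C\int_{\mathbb M_N}\Big(|\xi|\,|(\mathrm{grad}_\xi u)(\Theta)|+|\zeta|\,|(\mathrm{grad}_\zeta u)(\Theta)|+|\eta|\,|(\mathrm{grad}_\eta u)(\Theta)|+|u(\Theta)|\Big)\,dV(\Theta),$$ where the integrands on both sides are integrable. -/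

import Mathlib

namespace StokesType

noncomputable section

/-- Index set of the coordinates of `ℂ^l × ℂ^(n+1) × ℂ^(m+1)`. -/
abbrev Idx (l n m : ℕ) : Type := Fin l ⊕ Fin (n + 1) ⊕ Fin (m + 1)

/-- The ambient space `ℂ^l × ℂ^(n+1) × ℂ^(m+1) = ℂ^(|N|+2)`, `|N| = l + n + m`,
with its Euclidean norm. -/
abbrev Amb (l n m : ℕ) : Type := EuclideanSpace ℂ (Idx l n m)

variable {l n m : ℕ}

/-- The component `ξ ∈ ℂ^l` of `Θ = (ξ, ζ, η)`. -/
def xi (Θ : Amb l n m) : EuclideanSpace ℂ (Fin l) :=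
  WithLp.toLp 2 fun j => Θ (Sum.inl j)

/-- The component `ζ ∈ ℂ^(n+1)` of `Θ = (ξ, ζ, η)`. -/
def zeta (Θ : Amb l n m) : EuclideanSpace ℂ (Fin (n + 1)) :=
  WithLp.toLp 2 fun j => Θ (Sum.inr (Sum.inl j))

/-- The component `η ∈ ℂ^(m+1)` of `Θ = (ξ, ζ, η)`. -/
def eta (Θ : Amb l n m) : EuclideanSpace ℂ (Fin (m + 1)) :=
  WithLp.toLp 2 fun k => Θ (Sum.inr (Sum.inr k))

/-- The bilinear (not Hermitian) square `z • z = ∑ z_j ^ 2`. -/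
def bilinSq {k : ℕ} (z : EuclideanSpace ℂ (Fin k)) : ℂ := ∑ j, z j ^ 2

/-- The complex manifold `ℍ_N`. -/
def HN (l n m : ℕ) : Set (Amb l n m) :=
  {Θ | zeta Θ ≠ 0 ∧ eta Θ ≠ 0 ∧ bilinSq (zeta Θ) = 0 ∧ bilinSq (eta Θ) = 0}

/-- `𝕄_N`, the part of `ℍ_N` in the open Euclidean unit ball. -/
def MN (l n m : ℕ) : Set (Amb l n m) := HN l n m ∩ Metric.ball 0 1

/-- `∂𝕄_N`, the part of `ℍ_N` on the Euclidean unit sphere. -/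
def bdMN (l n m : ℕ) : Set (Amb l n m) := HN l n m ∩ Metric.sphere 0 1

/-- The canonical (Riemannian) volume measure `dV` of `ℍ_N`, a submanifold of real dimension
`2|N|`, i.e. the normalised `2|N|`-dimensional Hausdorff measure carried by `ℍ_N`. -/
def volHN (l n m : ℕ) : MeasureTheory.Measure (Amb l n m) :=
  (MeasureTheory.Measure.euclideanHausdorffMeasure (2 * (l + n + m))).restrict (HN l n m)

/-- The surface measure `dσ` of `∂𝕄_N`, a submanifold of real dimension `2|N| - 1`,
i.e. the normalised `(2|N| - 1)`-dimensional Hausdorff measure carried by `∂𝕄_N`. -/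
def surfMN (l n m : ℕ) : MeasureTheory.Measure (Amb l n m) :=
  (MeasureTheory.Measure.euclideanHausdorffMeasure (2 * (l + n + m) - 1)).restrict (bdMN l n m)

/-- `v ∈ C¹(closure of 𝕄_N)`: `v` is `C¹` on a relatively open neighbourhood of the closure of
`𝕄_N` in the closed unit ball. -/
def IsC1Closure (v : Amb l n m → ℂ) : Prop :=
  ∃ U : Set (Amb l n m), IsOpen U ∧ closure (MN l n m) ⊆ U ∧
    ContDiffOn ℝ 1 v (U ∩ Metric.closedBall 0 1)

/-- Euclidean norm at `Θ` of the gradient of `u` in the complex variables `Θ_(e k)`: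
the square root of the sum of `|∂u/∂(Re Θ_(e k))|² + |∂u/∂(Im Θ_(e k))|²` over `k`. -/
def gradNorm {κ : Type} [Fintype κ] (e : κ → Idx l n m) (u : Amb l n m → ℂ)
    (Θ : Amb l n m) : ℝ :=
  Real.sqrt (∑ k, (‖fderiv ℝ u Θ (EuclideanSpace.single (e k) 1)‖ ^ 2 +
    ‖fderiv ℝ u Θ (EuclideanSpace.single (e k) Complex.I)‖ ^ 2))

/-- `|grad_ξ u|`. -/
def gradXi (u : Amb l n m → ℂ) (Θ : Amb l n m) : ℝ :=
  gradNorm (fun j : Fin l => Sum.inl j) u Θ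

/-- `|grad_ζ u|`. -/
def gradZeta (u : Amb l n m → ℂ) (Θ : Amb l n m) : ℝ :=
  gradNorm (fun j : Fin (n + 1) => Sum.inr (Sum.inl j)) u Θ

/-- `|grad_η u|`. -/
def gradEta (u : Amb l n m → ℂ) (Θ : Amb l n m) : ℝ :=
  gradNorm (fun k : Fin (m + 1) => Sum.inr (Sum.inr k)) u Θ

/-- The function `u(Θ) = v(Θ) / (|ζ|^lam |η|^mu)`. -/
def weighted (v : Amb l n m → ℂ) (lam mu : ℝ) (Θ : Amb l n m) : ℂ :=
  v Θ / ((‖zeta Θ‖ ^ lam * ‖eta Θ‖ ^ mu : ℝ) : ℂ)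

/-- The integrand `|ξ||grad_ξ u| + |ζ||grad_ζ u| + |η||grad_η u| + |u|`. -/
def stokesIntegrand (u : Amb l n m → ℂ) (Θ : Amb l n m) : ℝ :=
  ‖xi Θ‖ * gradXi u Θ + ‖zeta Θ‖ * gradZeta u Θ + ‖eta Θ‖ * gradEta u Θ + ‖u Θ‖

end

end StokesType

/-!
Write `d = 2 (l + n + m)`. The set `HN` is a cone, and both halves of the statement come from moving
along its rays.

*The inequality.* For `ω` on the boundary, the fundamental theorem of calculus applied to
`r ↦ r ^ d u(r ω)`, which tends to `0` at the vertex, gives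
`|u(ω)| ≤ ∫₀¹ r ^ (d - 1) (d |u| + |Du(r ω)(r ω)|) dr`, and by Cauchy-Schwarz in each of the three
blocks of variables the bracket is at most `d` times the integrand of the statement
(`enorm_weighted_le_radial`). Integration over the link `∂𝕄` leads to an iterated integral, which has
to be compared with an integral over `𝕄`. Only an inequality is needed there, so the area formula can
be replaced by Eilenberg's inequality
`∫ μH[s] (A ∩ {‖x‖ = r}) dr ≤ μH[s + 1] A` (`lintegral_hausdorffMeasure_level_le`), whose proof uses
nothing but the coverings in the definition of Hausdorff measure; together with the scaling of
Hausdorff measure under dilations it yields `lintegral_link_radial_le`. The normalising constants of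
the two measures enter only the final constant.

*Integrability.* Since `v` and its derivative are bounded on `𝕄`, the integrand is at most a constant
times `|ζ| ^ (-lam) |η| ^ (-mu)`. The quadric `ζ • ζ = 0` is a finite union of pieces on which the
coordinate of greatest modulus is a Lipschitz function of the others
(`dist_apply_le_of_isotropic`): the difference of its squares is controlled by the other coordinates,
and two points of a common quadrant do not nearly cancel. On such a piece the Hausdorff measure is
dominated by Lebesgue measure on `ℂ^l × ℂ^n × ℂ^m`, where the weight is integrable near `0` as long as
`lam < 2 n` and `mu < 2 m` (`lintegral_MN_rpow_lt_top`). Integrability over the boundary then follows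
from the inequality itself.
-/

open MeasureTheory Set Filter Metric
open scoped ENNReal NNReal Topology Pointwise

namespace StokesType

/-! ### Eilenberg's inequality and cones -/

/-- Eilenberg's inequality for a `1`-Lipschitz real function: integrating the `s`-dimensional
Hausdorff measures of the level sets gives at most the `(s + 1)`-dimensional measure. -/
theorem lintegral_hausdorffMeasure_level_le {X : Type*} [EMetricSpace X] [MeasurableSpace X]
    [BorelSpace X] {f : X → ℝ} (hf : LipschitzWith 1 f) {s : ℝ} (hs : 0 < s) (A : Set X) :
    ∫⁻ r, μH[s] (A ∩ f ⁻¹' {r}) ≤ μH[s + 1] A := by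
  by_cases hA : μH[s + 1] A = ∞
  · simp [hA]
  set ε : ℕ → ℝ≥0∞ := fun k => ((k : ℝ≥0∞) + 1)⁻¹ with hε
  have hε0 : ∀ k, 0 < ε k := fun k => by simp [hε]
  have hεlim : Tendsto ε atTop (𝓝 0) := by
    have := (tendsto_add_atTop_iff_nat 1).2 ENNReal.tendsto_inv_nat_nhds_zero
    simpa [hε] using this
  have hcov : ∀ k, ∃ t : ℕ → Set X, A ⊆ ⋃ i, t i ∧ (∀ i, ediam (t i) ≤ ε k) ∧
      ∑' i, (⨆ _ : (t i).Nonempty, ediam (t i) ^ (s + 1)) < μH[s + 1] A + ε k := by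
    intro k
    have h1 : (⨅ (t : ℕ → Set X) (_ : A ⊆ ⋃ i, t i) (_ : ∀ i, ediam (t i) ≤ ε k),
        ∑' i, ⨆ _ : (t i).Nonempty, ediam (t i) ^ (s + 1)) < μH[s + 1] A + ε k := by
      refine lt_of_le_of_lt ?_ (ENNReal.lt_add_right hA (hε0 k).ne')
      rw [Measure.hausdorffMeasure_apply]
      exact le_iSup₂_of_le (ε k) (hε0 k) le_rfl
    simpa only [iInf_lt_iff, exists_prop] using h1
  choose t htA htd hts using hcov
  -- `h k r` is a measurable majorant of the premeasure of the level set at scale `ε k`; its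
  -- integral gains one power of the diameter since `f` maps a set of diameter `δ` into length `δ`.
  set h : ℕ → ℝ → ℝ≥0∞ := fun k r =>
    ∑' i, (closure (f '' t k i)).indicator (fun _ => ediam (t k i) ^ s) r with hh
  have hmeas : ∀ k, Measurable (h k) := fun k =>
    Measurable.tsum fun i => measurable_const.indicator isClosed_closure.measurableSet
  have hlevel : ∀ r, μH[s] (A ∩ f ⁻¹' {r}) ≤ liminf (fun k => h k r) atTop := by
    intro r
    refine (Measure.hausdorffMeasure_le_liminf_tsum s _ ε hεlim
      (fun k i => t k i ∩ f ⁻¹' {r}) (.of_forall fun k i =>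
        (ediam_mono inter_subset_left).trans (htd k i)) (.of_forall fun k => ?_)).trans ?_
    · rw [← iUnion_inter]
      exact inter_subset_inter_left _ (htA k)
    · refine liminf_le_liminf (.of_forall fun k => ENNReal.tsum_le_tsum fun i => ?_)
      rcases (t k i ∩ f ⁻¹' {r}).eq_empty_or_nonempty with he | ⟨x, hx, hxr⟩
      · simp [he, hs]
      · rw [indicator_of_mem (subset_closure (show r ∈ f '' t k i from ⟨x, hx, hxr⟩))]
        exact ENNReal.rpow_le_rpow (ediam_mono inter_subset_left) hs.le
  have hint : ∀ k, ∫⁻ r, h k r ≤ μH[s + 1] A + ε k := by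
    intro k
    rw [hh, lintegral_tsum fun i =>
      (measurable_const.indicator isClosed_closure.measurableSet).aemeasurable]
    refine (ENNReal.tsum_le_tsum fun i => ?_).trans (hts k).le
    rw [lintegral_indicator_const isClosed_closure.measurableSet]
    rcases (t k i).eq_empty_or_nonempty with he | hne
    · simp [he]
    · rw [ciSup_pos hne, ENNReal.rpow_add_of_nonneg _ _ hs.le zero_le_one, ENNReal.rpow_one]
      gcongr
      calc volume (closure (f '' t k i)) ≤ ediam (closure (f '' t k i)) := Real.volume_le_diam _
        _ = ediam (f '' t k i) := ediam_closure _
        _ ≤ ediam (t k i) := by simpa using hf.ediam_image_le (t k i)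
  calc ∫⁻ r, μH[s] (A ∩ f ⁻¹' {r}) ≤ ∫⁻ r, liminf (fun k => h k r) atTop := lintegral_mono hlevel
    _ ≤ liminf (fun k => ∫⁻ r, h k r) atTop := lintegral_liminf_le hmeas
    _ ≤ liminf (fun k => μH[s + 1] A + ε k) atTop := liminf_le_liminf (.of_forall hint)
    _ = μH[s + 1] A := by
      simpa using (tendsto_const_nhds.add hεlim).liminf_eq

section Cone

variable {E : Type*} [NormedAddCommGroup E] [NormedSpace ℝ E] [MeasurableSpace E] [BorelSpace E]
  {A : Set E}

/-- Dilating the part of the unit link of a cone that lands in `B`. -/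
theorem rpow_mul_hausdorffMeasure_link_le (hA : ∀ r : ℝ, 0 < r → ∀ x ∈ A, r • x ∈ A)
    {s : ℝ} (hs : 0 ≤ s) {r : ℝ} (hr : r ∈ Ioo (0 : ℝ) 1) (B : Set E) :
    ENNReal.ofReal (r ^ s) * μH[s] ((A ∩ sphere 0 1) ∩ (fun x => r • x) ⁻¹' B) ≤
      μH[s] ((B ∩ (A ∩ ball 0 1)) ∩ (‖·‖) ⁻¹' {r}) := by
  have h := Measure.hausdorffMeasure_smul₀ hs hr.1.ne' ((A ∩ sphere 0 1) ∩ (fun x => r • x) ⁻¹' B)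
  have hc : ENNReal.ofReal (r ^ s) * μH[s] ((A ∩ sphere 0 1) ∩ (fun x => r • x) ⁻¹' B) =
      μH[s] (r • ((A ∩ sphere 0 1) ∩ (fun x => r • x) ⁻¹' B)) := by
    rw [h, ENNReal.smul_def, smul_eq_mul]
    congr 1
    rw [ENNReal.ofReal, Real.toNNReal_rpow_of_nonneg hr.1.le]
    congr 2
    ext
    simp [hr.1.le, abs_of_pos hr.1]
  rw [hc]
  refine measure_mono ?_
  rintro _ ⟨x, ⟨⟨hxA, hxS⟩, hxB⟩, rfl⟩
  have hn : ‖r • x‖ = r := by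
    rw [norm_smul, mem_sphere_zero_iff_norm.1 hxS, mul_one, Real.norm_of_nonneg hr.1.le]
  refine ⟨⟨hxB, hA r hr.1 x hxA, ?_⟩, hn⟩
  simpa [hn] using hr.2

/-- If the cone has finite measure in the unit ball, its link has finite measure: the dilates of the
link by `r ∈ (1/2, 1)` have comparable measures, and Eilenberg's inequality bounds their integral. -/
theorem hausdorffMeasure_link_lt_top (hA : ∀ r : ℝ, 0 < r → ∀ x ∈ A, r • x ∈ A)
    {s : ℝ} (hs : 0 < s) (hfin : μH[s + 1] (A ∩ ball 0 1) < ∞) :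
    μH[s] (A ∩ sphere 0 1) < ∞ := by
  have h1 : ∫⁻ r in Ioo (1 / 2 : ℝ) 1, ENNReal.ofReal ((1 / 2) ^ s) * μH[s] (A ∩ sphere 0 1) ≤
      μH[s + 1] (A ∩ ball 0 1) := by
    calc _ ≤ ∫⁻ r in Ioo (1 / 2 : ℝ) 1, μH[s] ((A ∩ ball 0 1) ∩ (‖·‖) ⁻¹' {r}) := by
          refine setLIntegral_mono' measurableSet_Ioo fun r hr => ?_
          have hr0 : r ∈ Ioo (0 : ℝ) 1 := ⟨by linarith [hr.1], hr.2⟩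
          have := rpow_mul_hausdorffMeasure_link_le hA hs.le hr0 univ
          simp only [preimage_univ, inter_univ, univ_inter] at this
          refine le_trans ?_ this
          gcongr
          exact hr.1.le
      _ ≤ ∫⁻ r, μH[s] ((A ∩ ball 0 1) ∩ (‖·‖) ⁻¹' {r}) := setLIntegral_le_lintegral _ _
      _ ≤ _ := lintegral_hausdorffMeasure_level_le lipschitzWith_one_norm hs _
  by_contra hcon
  rw [not_lt, top_le_iff] at hcon
  rw [hcon, ENNReal.mul_top (by simp; positivity), setLIntegral_const, Real.volume_Ioo,
    ENNReal.top_mul (by norm_num)] at h1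
  exact absurd h1 (not_le.2 hfin)

/-- Integration in polar coordinates over the part of a cone in the unit ball dominates, for
Hausdorff measures, the iterated integral over the link and the radius. -/
theorem lintegral_link_radial_le [SecondCountableTopology E]
    (hA : ∀ r : ℝ, 0 < r → ∀ x ∈ A, r • x ∈ A) {s : ℝ} (hs : 0 < s) (hfin : μH[s + 1] (A ∩ ball 0 1) < ∞)
    {g : E → ℝ≥0∞} (hg : Measurable g) :
    ∫⁻ ω in A ∩ sphere 0 1, (∫⁻ r in Ioo (0 : ℝ) 1, ENNReal.ofReal (r ^ s) * g (r • ω)) ∂μH[s] ≤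
      ∫⁻ x in A ∩ ball 0 1, g x ∂μH[s + 1] := by
  set σ : Measure E := μH[s].restrict (A ∩ sphere 0 1) with hσ
  have : IsFiniteMeasure σ := ⟨by
    simpa [hσ] using hausdorffMeasure_link_lt_top hA hs hfin⟩
  have hw : Measurable fun r : ℝ => ENNReal.ofReal (r ^ s) := by fun_prop
  set ν : Measure ℝ := (volume.restrict (Ioo (0 : ℝ) 1)).withDensity
    fun r => ENNReal.ofReal (r ^ s) with hν
  set ψ : E × ℝ → E := fun p => p.2 • p.1 with hψ
  have hψm : Measurable ψ := (continuous_snd.smul continuous_fst).measurable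
  have hle : (σ.prod ν).map ψ ≤ μH[s + 1].restrict (A ∩ ball 0 1) := by
    refine Measure.le_iff.2 fun B hB => ?_
    rw [Measure.map_apply hψm hB, Measure.prod_apply_symm (hψm hB), hν,
      lintegral_withDensity_eq_lintegral_mul _ hw (measurable_measure_prodMk_right (hψm hB)),
      Measure.restrict_apply hB]
    refine le_trans (setLIntegral_mono' measurableSet_Ioo fun r hr => ?_)
      ((setLIntegral_le_lintegral _ _).trans
        (lintegral_hausdorffMeasure_level_le lipschitzWith_one_norm hs _))
    have hm : MeasurableSet ((fun x : E => r • x) ⁻¹' B) :=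
      (measurable_const_smul r) hB
    have h2 : σ ((fun x => (x, r)) ⁻¹' (ψ ⁻¹' B)) =
        μH[s] ((A ∩ sphere 0 1) ∩ (fun x => r • x) ⁻¹' B) := by
      change σ ((fun x : E => r • x) ⁻¹' B) = _
      rw [hσ, Measure.restrict_apply hm, inter_comm]
    simp only [Pi.mul_apply]
    rw [h2]
    exact rpow_mul_hausdorffMeasure_link_le hA hs.le hr B
  calc _ = ∫⁻ ω, (∫⁻ r, g (ψ (ω, r)) ∂ν) ∂σ := by
        refine lintegral_congr fun ω => ?_
        rw [hν, lintegral_withDensity_eq_lintegral_mul _ hw]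
        · rfl
        · exact hg.comp (hψm.comp measurable_prodMk_left)
    _ = ∫⁻ p, g (ψ p) ∂(σ.prod ν) := (lintegral_prod _ (hg.comp hψm).aemeasurable).symm
    _ = ∫⁻ x, g x ∂((σ.prod ν).map ψ) := (lintegral_map hg hψm).symm
    _ ≤ _ := lintegral_mono' hle le_rfl

end Cone

/-! ### Lipschitz charts of the isotropic cone -/

/-- Change of variables as an inequality: a map that is antilipschitz on `T` pushes the Hausdorff
measure on `T` to a measure dominated by the Hausdorff measure of the target. -/
theorem setLIntegral_comp_le_of_antilipschitz {X Y : Type*} [EMetricSpace X] [MeasurableSpace X]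
    [BorelSpace X] [EMetricSpace Y] [MeasurableSpace Y] [BorelSpace Y] {P : X → Y}
    (hP : Measurable P) {T : Set X} {K : ℝ≥0}
    (hK : ∀ x ∈ T, ∀ y ∈ T, edist x y ≤ K * edist (P x) (P y)) {d : ℝ} (hd : 0 ≤ d)
    {h : Y → ℝ≥0∞} (hh : Measurable h) :
    ∫⁻ x in T, h (P x) ∂μH[d] ≤ (K : ℝ≥0∞) ^ d * ∫⁻ y, h y ∂μH[d] := by
  have hle : (μH[d].restrict T).map P ≤ ((K : ℝ≥0∞) ^ d) • (μH[d] : Measure Y) := by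
    refine Measure.le_iff.2 fun S hS => ?_
    rw [Measure.map_apply hP hS, Measure.restrict_apply (hP hS), Measure.smul_apply, smul_eq_mul]
    have hanti : AntilipschitzWith K (fun x : T => P x) := fun x y => hK x x.2 y y.2
    have := hanti.hausdorffMeasure_preimage_le hd S
    rwa [← isometry_subtype_coe.hausdorffMeasure_image (.inl hd),
      show (Subtype.val '' ((fun x : T => P x) ⁻¹' S)) = P ⁻¹' S ∩ T by
        ext x; simp [and_comm]] at this
  rw [← lintegral_map hh hP]
  exact (lintegral_mono' hle le_rfl).trans_eq (lintegral_smul_measure _ _)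

/-- The closed quadrant of the complex plane obtained by rotating the first one by `c⁻¹`. -/
def quadrant (c : ℂ) : Set ℂ := {w | 0 ≤ (c * w).re ∧ 0 ≤ (c * w).im}

/-- The rotations by the powers of `I` give the four quadrants of the plane, which cover it. -/
theorem exists_mem_quadrant (w : ℂ) : ∃ a : Fin 4, w ∈ quadrant (Complex.I ^ (a : ℕ)) := by
  have h2 : Complex.I ^ 2 = -1 := Complex.I_sq
  have h3 : Complex.I ^ 3 = -Complex.I := by rw [pow_succ, h2]; ring
  rcases le_total 0 w.re with hr | hr <;> rcases le_total 0 w.im with hi | hi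
  · exact ⟨0, by simp [quadrant, hr, hi]⟩
  · exact ⟨1, by simp [quadrant, hr, hi]⟩
  · exact ⟨3, by simp [quadrant, hr, hi, h3]⟩
  · exact ⟨2, by simp [quadrant, hr, hi]⟩

/-- Two points of a common quadrant make an angle of at most a right angle. -/
theorem max_norm_le_norm_add_of_mem_quadrant {c z w : ℂ} (hc : ‖c‖ = 1) (hz : z ∈ quadrant c)
    (hw : w ∈ quadrant c) : max ‖z‖ ‖w‖ ≤ ‖z + w‖ := by
  have key : ∀ {z w : ℂ}, z ∈ quadrant c → w ∈ quadrant c → ‖z‖ ≤ ‖z + w‖ := by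
    intro z w hz hw
    have e : ∀ x : ℂ, ‖x‖ = ‖c * x‖ := fun x => by rw [norm_mul, hc, one_mul]
    rw [e z, e (z + w), mul_add]
    refine abs_le_of_sq_le_sq' ?_ (norm_nonneg _) |>.2
    rw [Complex.sq_norm, Complex.sq_norm, Complex.normSq_apply, Complex.normSq_apply]
    simp only [Complex.add_re, Complex.add_im]
    nlinarith [mul_nonneg hz.1 hw.1, mul_nonneg hz.2 hw.2, sq_nonneg (c * w).re,
      sq_nonneg (c * w).im]
  refine max_le (key hz hw) ?_
  rw [add_comm]
  exact key hw hz

/-- On the part of the isotropic cone where the `j`-th coordinate has the greatest modulus and lies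
in a fixed quadrant, the `j`-th coordinate is a Lipschitz function of the other ones. -/
theorem dist_apply_le_of_isotropic {k : ℕ} {z w : Fin (k + 1) → ℂ} (hz : ∑ i, z i ^ 2 = 0)
    (hw : ∑ i, w i ^ 2 = 0) {j : Fin (k + 1)} (hzj : ∀ i, ‖z i‖ ≤ ‖z j‖)
    (hwj : ∀ i, ‖w i‖ ≤ ‖w j‖) {c : ℂ} (hc : ‖c‖ = 1) (hzc : z j ∈ quadrant c)
    (hwc : w j ∈ quadrant c) :
    dist (z j) (w j) ≤ 2 * k * dist (fun i => z (j.succAbove i)) (fun i => w (j.succAbove i)) := by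
  set D := dist (fun i => z (j.succAbove i)) (fun i => w (j.succAbove i)) with hD
  have hD0 : 0 ≤ D := dist_nonneg
  set M := max ‖z j‖ ‖w j‖ with hM
  have hM0 : 0 ≤ M := (norm_nonneg _).trans (le_max_left _ _)
  rcases hM0.eq_or_lt with h0 | hpos
  · have h1 : z j = 0 := norm_le_zero_iff.1 ((le_max_left _ _).trans h0.ge)
    have h2 : w j = 0 := norm_le_zero_iff.1 ((le_max_right _ _).trans h0.ge)
    rw [h1, h2, dist_self]
    positivity
  -- Subtract the two quadratic equations and factor the differences of squares.
  have hfac : (z j - w j) * (z j + w j) =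
      -∑ i, (z (j.succAbove i) - w (j.succAbove i)) * (z (j.succAbove i) + w (j.succAbove i)) := by
    rw [Fin.sum_univ_succAbove _ j] at hz hw
    have : ∑ i, (z (j.succAbove i) - w (j.succAbove i)) * (z (j.succAbove i) + w (j.succAbove i)) =
        ∑ i, z (j.succAbove i) ^ 2 - ∑ i, w (j.succAbove i) ^ 2 := by
      rw [← Finset.sum_sub_distrib]
      exact Finset.sum_congr rfl fun i _ => by ring
    rw [this]
    linear_combination hz - hw
  have hterm : ‖(z j - w j) * (z j + w j)‖ ≤ k * (D * (2 * M)) := by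
    rw [hfac, norm_neg]
    refine (norm_sum_le_of_le (f := fun i => (z (j.succAbove i) - w (j.succAbove i)) *
      (z (j.succAbove i) + w (j.succAbove i))) (n := fun _ => D * (2 * M)) _ fun i _ => ?_).trans ?_
    · rw [norm_mul]
      refine mul_le_mul ?_ ?_ (norm_nonneg _) hD0
      · rw [← dist_eq_norm]
        exact dist_le_pi_dist (fun i => z (j.succAbove i)) (fun i => w (j.succAbove i)) i
      · refine (norm_add_le _ _).trans ?_
        have h1 := (hzj (j.succAbove i)).trans (le_max_left _ ‖w j‖)
        have h2 := (hwj (j.succAbove i)).trans (le_max_right ‖z j‖ _)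
        linarith
    · simp
  rw [norm_mul, ← dist_eq_norm] at hterm
  have hsum : M ≤ ‖z j + w j‖ := max_norm_le_norm_add_of_mem_quadrant hc hzc hwc
  have h3 : dist (z j) (w j) * M ≤ dist (z j) (w j) * ‖z j + w j‖ := by gcongr
  refine le_of_mul_le_mul_right ?_ hpos
  linarith

variable {l n m : ℕ}

/-- The coordinate projection that forgets the coordinates `ζ_j` and `η_k`. The target carries the
supremum norm, which is dominated by the Euclidean one. -/
def forget (j : Fin (n + 1)) (k : Fin (m + 1)) (Θ : Amb l n m) :
    (Fin l → ℂ) × (Fin n → ℂ) × (Fin m → ℂ) :=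
  (fun i => xi Θ i, fun i => zeta Θ (j.succAbove i), fun i => eta Θ (k.succAbove i))

/-- The part of `ℍ_N` where `ζ_j` and `η_k` are coordinates of greatest modulus of `ζ` and `η` and
lie in prescribed quadrants. -/
def chartPiece (l : ℕ) (p : (Fin (n + 1) × Fin 4) × (Fin (m + 1) × Fin 4)) : Set (Amb l n m) :=
  {Θ | Θ ∈ HN l n m ∧
    ((∀ i, ‖zeta Θ i‖ ≤ ‖zeta Θ p.1.1‖) ∧ zeta Θ p.1.1 ∈ quadrant (Complex.I ^ (p.1.2 : ℕ))) ∧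
    ((∀ i, ‖eta Θ i‖ ≤ ‖eta Θ p.2.1‖) ∧ eta Θ p.2.1 ∈ quadrant (Complex.I ^ (p.2.2 : ℕ)))}

theorem HN_subset_iUnion_chartPiece : HN l n m ⊆ ⋃ p, chartPiece l p := by
  intro Θ hΘ
  obtain ⟨j, hj⟩ := Finite.exists_max fun i => ‖zeta Θ i‖
  obtain ⟨k, hk⟩ := Finite.exists_max fun i => ‖eta Θ i‖
  obtain ⟨a, ha⟩ := exists_mem_quadrant (zeta Θ j)
  obtain ⟨b, hb⟩ := exists_mem_quadrant (eta Θ k)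
  exact mem_iUnion.2 ⟨((j, a), (k, b)), hΘ, ⟨hj, ha⟩, ⟨hk, hb⟩⟩

theorem continuous_zeta : Continuous (zeta : Amb l n m → _) := by
  unfold zeta; fun_prop

theorem continuous_eta : Continuous (eta : Amb l n m → _) := by
  unfold eta; fun_prop

theorem continuous_xi : Continuous (xi : Amb l n m → _) := by
  unfold xi; fun_prop

theorem continuous_forget (j : Fin (n + 1)) (k : Fin (m + 1)) :
    Continuous (forget j k : Amb l n m → _) := by
  unfold forget xi zeta eta
  fun_prop

/-- The projection that forgets `ζ_j` and `η_k` is antilipschitz on each chart piece. -/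
theorem exists_edist_le_forget (p : (Fin (n + 1) × Fin 4) × (Fin (m + 1) × Fin 4)) :
    ∃ K : ℝ≥0, ∀ x ∈ chartPiece l p, ∀ y ∈ chartPiece l p,
      edist x y ≤ K * edist (forget p.1.1 p.2.1 x) (forget p.1.1 p.2.1 y) := by
  obtain ⟨C, hC⟩ : ∃ C : ℝ≥0, LipschitzWith C (WithLp.toLp 2 : (Idx l n m → ℂ) → Amb l n m) :=
    ⟨_, PiLp.lipschitzWith_toLp 2 _⟩
  refine ⟨C * (2 * n + 2 * m + 1), fun x hx y hy => ?_⟩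
  set D := dist (forget p.1.1 p.2.1 x) (forget p.1.1 p.2.1 y) with hD
  have hD0 : 0 ≤ D := dist_nonneg
  have hI : ∀ a : ℕ, ‖Complex.I ^ a‖ = 1 := fun a => by simp
  have hξ : dist (forget p.1.1 p.2.1 x).1 (forget p.1.1 p.2.1 y).1 ≤ D := le_max_left _ _
  have hζ : dist (forget p.1.1 p.2.1 x).2.1 (forget p.1.1 p.2.1 y).2.1 ≤ D :=
    (le_max_left _ _).trans (le_max_right _ _)
  have hη : dist (forget p.1.1 p.2.1 x).2.2 (forget p.1.1 p.2.1 y).2.2 ≤ D :=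
    (le_max_right _ _).trans (le_max_right _ _)
  have hζj := dist_apply_le_of_isotropic hx.1.2.2.1 hy.1.2.2.1 hx.2.1.1 hy.2.1.1 (hI _)
    hx.2.1.2 hy.2.1.2
  have hηk := dist_apply_le_of_isotropic hx.1.2.2.2 hy.1.2.2.2 hx.2.2.1 hy.2.2.1 (hI _)
    hx.2.2.2 hy.2.2.2
  have hall : dist (WithLp.ofLp x) (WithLp.ofLp y) ≤ (2 * n + 2 * m + 1) * D := by
    have hnD : 0 ≤ (n : ℝ) * D := by positivity
    have hmD : 0 ≤ (m : ℝ) * D := by positivity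
    refine (dist_pi_le_iff (by positivity)).2 ?_
    rintro (i | i | i)
    · have : dist (xi x i) (xi y i) ≤ D := (dist_le_pi_dist _ _ i).trans hξ
      change dist (xi x i) (xi y i) ≤ _
      linarith
    · change dist (zeta x i) (zeta y i) ≤ _
      rcases Fin.eq_self_or_eq_succAbove p.1.1 i with rfl | ⟨i, rfl⟩
      · refine hζj.trans ?_
        have : 2 * (n : ℝ) * dist (fun i => zeta x (p.1.1.succAbove i))
          (fun i => zeta y (p.1.1.succAbove i)) ≤ 2 * n * D := by gcongr; exact hζ
        linarith
      · have := (dist_le_pi_dist _ _ i).trans hζ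
        simp only [forget] at this
        linarith
    · change dist (eta x i) (eta y i) ≤ _
      rcases Fin.eq_self_or_eq_succAbove p.2.1 i with rfl | ⟨i, rfl⟩
      · refine hηk.trans ?_
        have : 2 * (m : ℝ) * dist (fun i => eta x (p.2.1.succAbove i))
          (fun i => eta y (p.2.1.succAbove i)) ≤ 2 * m * D := by gcongr; exact hη
        linarith
      · have := (dist_le_pi_dist _ _ i).trans hη
        simp only [forget] at this
        linarith
  have h1 := hC.dist_le_mul (WithLp.ofLp x) (WithLp.ofLp y)
  have h2 : dist x y ≤ ((C * (2 * n + 2 * m + 1) : ℝ≥0) : ℝ) * D := by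
    refine (h1.trans (mul_le_mul_of_nonneg_left hall C.2)).trans_eq ?_
    push_cast
    ring
  rw [edist_dist, edist_dist, ← ENNReal.ofReal_coe_nnreal, ← ENNReal.ofReal_mul (NNReal.coe_nonneg _)]
  exact ENNReal.ofReal_le_ofReal h2

/-! ### Integrability of the weight -/

theorem lintegral_ball_norm_rpow_lt_top {k : ℕ} (hk : 1 ≤ k) {a : ℝ} (ha : a < 2 * k) :
    ∫⁻ y in ball (0 : Fin k → ℂ) 1, ENNReal.ofReal (‖y‖ ^ (-a)) < ∞ := by
  have hd : Module.finrank ℝ (Fin k → ℂ) = 2 * k := by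
    simp [Module.finrank_pi_fintype, Complex.finrank_real_complex, mul_comm]
  have hm : Measurable fun y : Fin k → ℂ => ‖y‖ ^ (-a) := by fun_prop
  have h := integrableOn_ball_of_norm_le_rpow (μ := (volume : Measure (Fin k → ℂ))) (C := 1)
    (α := a) (r := 1) (by omega) (by rw [hd]; exact_mod_cast ha)
    (f := fun y : Fin k → ℂ => ‖y‖ ^ (-a))
    (.of_forall fun y => by rw [Real.norm_of_nonneg (by positivity), one_mul])
    hm.aestronglyMeasurable
  exact h.lintegral_lt_top

theorem norm_xi_le (Θ : Amb l n m) : ‖xi Θ‖ ≤ ‖Θ‖ := by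
  rw [EuclideanSpace.norm_eq, EuclideanSpace.norm_eq]
  refine Real.sqrt_le_sqrt ?_
  simp only [Fintype.sum_sum_type, xi]
  have h1 : 0 ≤ ∑ i : Fin (n + 1), ‖Θ (Sum.inr (Sum.inl i))‖ ^ 2 := by positivity
  have h2 : 0 ≤ ∑ i : Fin (m + 1), ‖Θ (Sum.inr (Sum.inr i))‖ ^ 2 := by positivity
  linarith

theorem norm_zeta_le (Θ : Amb l n m) : ‖zeta Θ‖ ≤ ‖Θ‖ := by
  rw [EuclideanSpace.norm_eq, EuclideanSpace.norm_eq]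
  refine Real.sqrt_le_sqrt ?_
  simp only [Fintype.sum_sum_type, zeta]
  have h1 : 0 ≤ ∑ i : Fin l, ‖Θ (Sum.inl i)‖ ^ 2 := by positivity
  have h2 : 0 ≤ ∑ i : Fin (m + 1), ‖Θ (Sum.inr (Sum.inr i))‖ ^ 2 := by positivity
  linarith

theorem norm_eta_le (Θ : Amb l n m) : ‖eta Θ‖ ≤ ‖Θ‖ := by
  rw [EuclideanSpace.norm_eq, EuclideanSpace.norm_eq]
  refine Real.sqrt_le_sqrt ?_
  simp only [Fintype.sum_sum_type, eta]
  have h1 : 0 ≤ ∑ i : Fin l, ‖Θ (Sum.inl i)‖ ^ 2 := by positivity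
  have h2 : 0 ≤ ∑ i : Fin (n + 1), ‖Θ (Sum.inr (Sum.inl i))‖ ^ 2 := by positivity
  linarith

/-- Forgetting a coordinate of a nonzero isotropic vector does not give zero. -/
theorem comp_succAbove_ne_zero {k : ℕ} {z : EuclideanSpace ℂ (Fin (k + 1))} (hz : z ≠ 0)
    (h0 : bilinSq z = 0) (j : Fin (k + 1)) : (fun i => z (j.succAbove i)) ≠ 0 := by
  intro h
  have hi : ∀ i, z (j.succAbove i) = 0 := fun i => congrFun h i
  rw [bilinSq, Fin.sum_univ_succAbove _ j] at h0
  simp only [hi] at h0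
  have hj : z j = 0 := by simpa using h0
  refine hz (PiLp.ext fun i => ?_)
  rcases Fin.eq_self_or_eq_succAbove j i with rfl | ⟨i, rfl⟩
  · simpa using hj
  · simpa using hi i

theorem norm_comp_le {k r : ℕ} (z : EuclideanSpace ℂ (Fin k)) (e : Fin r → Fin k) :
    ‖fun i => z (e i)‖ ≤ ‖z‖ :=
  (pi_norm_le_iff_of_nonneg (norm_nonneg _)).2 fun i => PiLp.norm_apply_le z (e i)

/-- The weight is integrable on `𝕄_N`. The exponents are taken nonnegative so that passing to the
projected variables, of smaller norm, only increases the weight. -/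
theorem lintegral_MN_rpow_lt_top (hn : 1 ≤ n) (hm : 1 ≤ m) {a b : ℝ} (ha0 : 0 ≤ a)
    (ha : a < 2 * n) (hb0 : 0 ≤ b) (hb : b < 2 * m) :
    ∫⁻ Θ in MN l n m, ENNReal.ofReal (‖zeta Θ‖ ^ (-a) * ‖eta Θ‖ ^ (-b))
      ∂μH[((2 * (l + n + m) : ℕ) : ℝ)] < ∞ := by
  set d : ℕ := 2 * (l + n + m) with hd
  have hfr : Module.finrank ℝ ((Fin l → ℂ) × (Fin n → ℂ) × (Fin m → ℂ)) = d := by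
    simp [Module.finrank_prod, Module.finrank_pi_fintype, Complex.finrank_real_complex, hd]
    ring
  set h : (Fin l → ℂ) × (Fin n → ℂ) × (Fin m → ℂ) → ℝ≥0∞ := fun y =>
    (ball (0 : Fin l → ℂ) 1).indicator 1 y.1 *
      ((ball (0 : Fin n → ℂ) 1).indicator (fun y => ENNReal.ofReal (‖y‖ ^ (-a))) y.2.1 *
        (ball (0 : Fin m → ℂ) 1).indicator (fun y => ENNReal.ofReal (‖y‖ ^ (-b))) y.2.2) with hh
  have hm1 : Measurable ((ball (0 : Fin l → ℂ) 1).indicator (1 : (Fin l → ℂ) → ℝ≥0∞)) :=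
    measurable_one.indicator measurableSet_ball
  have hm2 : Measurable
      ((ball (0 : Fin n → ℂ) 1).indicator (fun y => ENNReal.ofReal (‖y‖ ^ (-a)))) :=
    Measurable.indicator (by fun_prop) measurableSet_ball
  have hm3 : Measurable
      ((ball (0 : Fin m → ℂ) 1).indicator (fun y => ENNReal.ofReal (‖y‖ ^ (-b)))) :=
    Measurable.indicator (by fun_prop) measurableSet_ball
  have hhm : Measurable h := (hm1.comp measurable_fst).mul
    ((hm2.comp measurable_snd.fst).mul (hm3.comp measurable_snd.snd))
  have hhv : ∫⁻ y, h y < ∞ := by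
    rw [hh, Measure.volume_eq_prod, lintegral_prod_mul (f := (ball (0 : Fin l → ℂ) 1).indicator 1)
      (g := fun y : (Fin n → ℂ) × (Fin m → ℂ) =>
        (ball (0 : Fin n → ℂ) 1).indicator (fun y => ENNReal.ofReal (‖y‖ ^ (-a))) y.1 *
        (ball (0 : Fin m → ℂ) 1).indicator (fun y => ENNReal.ofReal (‖y‖ ^ (-b))) y.2)
      hm1.aemeasurable ((hm2.comp measurable_fst).mul (hm3.comp measurable_snd)).aemeasurable,
      Measure.volume_eq_prod, lintegral_prod_mul hm2.aemeasurable hm3.aemeasurable,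
      lintegral_indicator_one measurableSet_ball, lintegral_indicator measurableSet_ball,
      lintegral_indicator measurableSet_ball]
    exact ENNReal.mul_lt_top measure_ball_lt_top (ENNReal.mul_lt_top
      (lintegral_ball_norm_rpow_lt_top hn ha) (lintegral_ball_norm_rpow_lt_top hm hb))
  have hhH : ∫⁻ y, h y ∂μH[(d : ℝ)] < ∞ := by
    have : (μH[(d : ℝ)] : Measure ((Fin l → ℂ) × (Fin n → ℂ) × (Fin m → ℂ))).IsAddHaarMeasure := by
      rw [← hfr]
      exact isAddHaarMeasure_hausdorffMeasure
    have h23 : (volume : Measure ((Fin n → ℂ) × (Fin m → ℂ))).IsAddHaarMeasure :=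
      Measure.prod.instIsAddHaarMeasure _ _
    have hvol : (volume : Measure ((Fin l → ℂ) × (Fin n → ℂ) × (Fin m → ℂ))).IsAddHaarMeasure :=
      Measure.prod.instIsAddHaarMeasure _ _
    rw [Measure.isAddLeftInvariant_eq_smul μH[(d : ℝ)]
      (volume : Measure ((Fin l → ℂ) × (Fin n → ℂ) × (Fin m → ℂ)))]
    rw [lintegral_smul_measure]
    exact ENNReal.mul_lt_top ENNReal.coe_lt_top hhv
  have hpiece : ∀ p : (Fin (n + 1) × Fin 4) × (Fin (m + 1) × Fin 4),
      ∫⁻ Θ in chartPiece l p ∩ MN l n m, ENNReal.ofReal (‖zeta Θ‖ ^ (-a) * ‖eta Θ‖ ^ (-b))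
        ∂μH[(d : ℝ)] < ∞ := by
    intro p
    obtain ⟨K, hK⟩ := exists_edist_le_forget (l := l) p
    have hF := (continuous_forget (l := l) p.1.1 p.2.1).measurable
    refine lt_of_le_of_lt ?_ (ENNReal.mul_lt_top
      (ENNReal.rpow_lt_top_of_nonneg (Nat.cast_nonneg d) (ENNReal.coe_ne_top (r := K))) hhH)
    refine le_trans (setLIntegral_mono (hhm.comp hF) fun Θ hΘ => ?_)
      (setLIntegral_comp_le_of_antilipschitz hF
        (fun x hx y hy => hK x hx.1 y hy.1) (Nat.cast_nonneg d) hhm)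
    obtain ⟨hp, hHN, hball⟩ := hΘ
    rw [mem_ball_zero_iff] at hball
    have z1 := norm_comp_le (zeta Θ) p.1.1.succAbove
    have z2 := norm_pos_iff.2 (comp_succAbove_ne_zero hHN.1 hHN.2.2.1 p.1.1)
    have z3 := norm_zeta_le Θ
    have e1 := norm_comp_le (eta Θ) p.2.1.succAbove
    have e2 := norm_pos_iff.2 (comp_succAbove_ne_zero hHN.2.1 hHN.2.2.2 p.2.1)
    have e3 := norm_eta_le Θ
    have x1 := norm_comp_le (xi Θ) id
    have x3 := norm_xi_le Θ
    simp only [Function.comp_apply, hh, forget]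
    rw [indicator_of_mem (mem_ball_zero_iff.2 (by simp only [id] at x1; linarith)),
      indicator_of_mem (mem_ball_zero_iff.2 (by linarith)),
      indicator_of_mem (mem_ball_zero_iff.2 (by linarith)), Pi.one_apply, one_mul,
      ← ENNReal.ofReal_mul (by positivity)]
    refine ENNReal.ofReal_le_ofReal (mul_le_mul ?_ ?_ (by positivity) (by positivity))
    · exact Real.rpow_le_rpow_of_nonpos z2 z1 (by linarith)
    · exact Real.rpow_le_rpow_of_nonpos e2 e1 (by linarith)
  have hcov : MN l n m ⊆ ⋃ p, chartPiece l p ∩ MN l n m := by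
    rw [← iUnion_inter]
    exact subset_inter (inter_subset_left.trans HN_subset_iUnion_chartPiece) le_rfl
  refine (lintegral_mono_set hcov).trans_lt ((lintegral_iUnion_le _ _).trans_lt ?_)
  rw [tsum_fintype]
  exact ENNReal.sum_lt_top.2 fun p _ => hpiece p

/-! ### The cone structure of `ℍ_N` -/

theorem zeta_smul (r : ℝ) (Θ : Amb l n m) : zeta (r • Θ) = r • zeta Θ := by
  ext i; simp [zeta]

theorem eta_smul (r : ℝ) (Θ : Amb l n m) : eta (r • Θ) = r • eta Θ := by
  ext i; simp [eta]

theorem bilinSq_smul {k : ℕ} (r : ℝ) (z : EuclideanSpace ℂ (Fin k)) :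
    bilinSq (r • z) = (r : ℂ) ^ 2 * bilinSq z := by
  simp [bilinSq, mul_pow, Finset.mul_sum]

theorem smul_mem_HN (r : ℝ) (hr : 0 < r) (Θ : Amb l n m) (h : Θ ∈ HN l n m) :
    r • Θ ∈ HN l n m := by
  obtain ⟨h1, h2, h3, h4⟩ := h
  refine ⟨?_, ?_, ?_, ?_⟩
  · rw [zeta_smul]; exact smul_ne_zero hr.ne' h1
  · rw [eta_smul]; exact smul_ne_zero hr.ne' h2
  · rw [zeta_smul, bilinSq_smul, h3, mul_zero]
  · rw [eta_smul, bilinSq_smul, h4, mul_zero]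

theorem smul_mem_MN {r : ℝ} (hr : r ∈ Ioo (0 : ℝ) 1) {Θ : Amb l n m} (h : Θ ∈ bdMN l n m) :
    r • Θ ∈ MN l n m := by
  refine ⟨smul_mem_HN r hr.1 Θ h.1, ?_⟩
  rw [mem_ball_zero_iff, norm_smul, mem_sphere_zero_iff_norm.1 h.2, mul_one,
    Real.norm_of_nonneg hr.1.le]
  exact hr.2

theorem bdMN_subset_closure : bdMN l n m ⊆ closure (MN l n m) := by
  intro Θ hΘ
  have h : Tendsto (fun r : ℝ => r • Θ) (𝓝[<] 1) (𝓝 Θ) := by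
    have : Continuous fun r : ℝ => r • Θ := by fun_prop
    simpa using (this.tendsto 1).mono_left nhdsWithin_le_nhds
  refine mem_closure_of_tendsto h ?_
  filter_upwards [Ioo_mem_nhdsLT (show (0 : ℝ) < 1 by norm_num)] with r hr
  exact smul_mem_MN hr hΘ

theorem continuous_bilinSq {k : ℕ} :
    Continuous (bilinSq : EuclideanSpace ℂ (Fin k) → ℂ) := by
  unfold bilinSq; fun_prop

theorem measurableSet_HN : MeasurableSet (HN l n m) := by
  have h1 : IsOpen {Θ : Amb l n m | zeta Θ ≠ 0} := isOpen_ne_fun continuous_zeta continuous_const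
  have h2 : IsOpen {Θ : Amb l n m | eta Θ ≠ 0} := isOpen_ne_fun continuous_eta continuous_const
  have h3 : IsClosed {Θ : Amb l n m | bilinSq (zeta Θ) = 0} :=
    isClosed_eq (continuous_bilinSq.comp continuous_zeta) continuous_const
  have h4 : IsClosed {Θ : Amb l n m | bilinSq (eta Θ) = 0} :=
    isClosed_eq (continuous_bilinSq.comp continuous_eta) continuous_const
  exact h1.measurableSet.inter (h2.measurableSet.inter (h3.measurableSet.inter h4.measurableSet))

theorem measurableSet_MN : MeasurableSet (MN l n m) :=
  measurableSet_HN.inter measurableSet_ball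

theorem measurableSet_bdMN : MeasurableSet (bdMN l n m) :=
  measurableSet_HN.inter isClosed_sphere.measurableSet

/-! ### The weight and its derivative -/

/-- The weight `|ζ|^(-lam) |η|^(-mu)`. -/
noncomputable def weight (lam mu : ℝ) (Θ : Amb l n m) : ℝ :=
  ‖zeta Θ‖ ^ (-lam) * ‖eta Θ‖ ^ (-mu)

theorem weight_nonneg (lam mu : ℝ) (Θ : Amb l n m) : 0 ≤ weight lam mu Θ := by
  unfold weight; positivity

theorem weighted_eq (v : Amb l n m → ℂ) (lam mu : ℝ) :
    weighted v lam mu = fun Θ => weight lam mu Θ • v Θ := by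
  funext Θ
  rw [weighted, weight, Real.rpow_neg (norm_nonneg _), Real.rpow_neg (norm_nonneg _), ← mul_inv,
    Complex.real_smul, Complex.ofReal_inv, div_eq_inv_mul]

theorem norm_weighted (v : Amb l n m → ℂ) (lam mu : ℝ) (Θ : Amb l n m) :
    ‖weighted v lam mu Θ‖ = weight lam mu Θ * ‖v Θ‖ := by
  rw [weighted_eq, norm_smul, Real.norm_of_nonneg (weight_nonneg _ _ _)]

/-- The complement of the two coordinate subspaces where the weight may be singular. -/
def regularSet (l n m : ℕ) : Set (Amb l n m) := {Θ | zeta Θ ≠ 0 ∧ eta Θ ≠ 0}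

theorem isOpen_regularSet : IsOpen (regularSet l n m) :=
  (isOpen_ne_fun continuous_zeta continuous_const).inter
    (isOpen_ne_fun continuous_eta continuous_const)

/-- The projection to `ζ` as a real continuous linear map. -/
noncomputable def zetaL (l n m : ℕ) : Amb l n m →L[ℝ] EuclideanSpace ℂ (Fin (n + 1)) where
  toFun := zeta
  map_add' _ _ := by ext; simp [zeta]
  map_smul' r Θ := zeta_smul r Θ
  cont := continuous_zeta

/-- The projection to `η` as a real continuous linear map. -/
noncomputable def etaL (l n m : ℕ) : Amb l n m →L[ℝ] EuclideanSpace ℂ (Fin (m + 1)) where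
  toFun := eta
  map_add' _ _ := by ext; simp [eta]
  map_smul' r Θ := eta_smul r Θ
  cont := continuous_eta

theorem contDiffOn_weight (lam mu : ℝ) :
    ContDiffOn ℝ 1 (weight lam mu) (regularSet l n m) := by
  have h1 : ContDiffOn ℝ 1 (fun Θ : Amb l n m => ‖zeta Θ‖) (regularSet l n m) :=
    ((zetaL l n m).contDiff.contDiffOn).norm ℂ fun Θ hΘ => hΘ.1
  have h2 : ContDiffOn ℝ 1 (fun Θ : Amb l n m => ‖eta Θ‖) (regularSet l n m) :=
    ((etaL l n m).contDiff.contDiffOn).norm ℂ fun Θ hΘ => hΘ.2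
  exact (h1.rpow_const_of_ne fun Θ hΘ => norm_ne_zero_iff.2 hΘ.1).mul
    (h2.rpow_const_of_ne fun Θ hΘ => norm_ne_zero_iff.2 hΘ.2)

/-- The derivative of `‖T y‖ ^ p`, bounded in the form `‖T x‖ |L h| ≤ |p| ‖T x‖ ^ p ‖T h‖` that
keeps the exponent `p` of the weight. -/
theorem exists_hasFDerivAt_norm_rpow {E F : Type*} [NormedAddCommGroup E] [NormedSpace ℝ E]
    [NormedAddCommGroup F] [InnerProductSpace ℂ F] (T : E →L[ℝ] F) {x : E}
    (hx : T x ≠ 0) (p : ℝ) :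
    ∃ L : E →L[ℝ] ℝ, HasFDerivAt (fun y => ‖T y‖ ^ p) L x ∧
      ∀ h, ‖T x‖ * |L h| ≤ |p| * ‖T x‖ ^ p * ‖T h‖ := by
  have hpos : 0 < ‖T x‖ := norm_pos_iff.2 hx
  have hd : HasFDerivAt (norm : F → ℝ) (fderiv ℝ norm (T x)) (T x) :=
    ((contDiffAt_norm ℂ hx (n := 1)).differentiableAt one_ne_zero).hasFDerivAt
  refine ⟨_, (hd.comp x T.hasFDerivAt).rpow_const (p := p) (.inl hpos.ne'), fun h => ?_⟩
  have hb : |fderiv ℝ norm (T x) (T h)| ≤ ‖T h‖ := by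
    have := (fderiv ℝ (norm : F → ℝ) (T x)).le_of_opNorm_le
      (norm_fderiv_le_of_lipschitz ℝ lipschitzWith_one_norm) (T h)
    simpa using this
  have hpow : ‖T x‖ * ‖T x‖ ^ (p - 1) = ‖T x‖ ^ p := by
    rw [Real.rpow_sub_one hpos.ne']
    field_simp
  simp only [Function.comp_apply, smul_apply, ContinuousLinearMap.comp_apply,
    smul_eq_mul, abs_mul]
  rw [abs_of_nonneg (Real.rpow_nonneg hpos.le (p - 1))]
  calc ‖T x‖ * (|p| * ‖T x‖ ^ (p - 1) * |fderiv ℝ norm (T x) (T h)|)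
      = |p| * (‖T x‖ * ‖T x‖ ^ (p - 1)) * |fderiv ℝ norm (T x) (T h)| := by ring
    _ ≤ |p| * ‖T x‖ ^ p * ‖T h‖ := by rw [hpow]; gcongr

/-- A factor `t` bounded by `|ζ|` or `|η|` absorbs the extra singularity that a derivative of the
weight creates; directions `h` with vanishing `ζ` or `η` component create none there. -/
theorem norm_fderiv_weighted_apply_le {v : Amb l n m → ℂ} {Θ : Amb l n m} {K : ℝ}
    (hΘ : Θ ∈ regularSet l n m) (hv : DifferentiableAt ℝ v Θ) (hvK : ‖v Θ‖ ≤ K)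
    (hdK : ‖fderiv ℝ v Θ‖ ≤ K) (lam mu : ℝ) {t : ℝ} (ht0 : 0 ≤ t) (ht1 : t ≤ 1) {h : Amb l n m}
    (hh : ‖h‖ ≤ 1) (hζ : t ≤ ‖zeta Θ‖ ∨ zeta h = 0) (hη : t ≤ ‖eta Θ‖ ∨ eta h = 0) :
    t * ‖fderiv ℝ (weighted v lam mu) Θ h‖ ≤ K * (1 + |lam| + |mu|) * weight lam mu Θ := by
  obtain ⟨L1, hL1, hb1⟩ := exists_hasFDerivAt_norm_rpow (zetaL l n m) hΘ.1 (-lam)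
  obtain ⟨L2, hL2, hb2⟩ := exists_hasFDerivAt_norm_rpow (etaL l n m) hΘ.2 (-mu)
  have hw : HasFDerivAt (weight lam mu) _ Θ := hL1.mul hL2
  have hu := hw.fun_smul hv.hasFDerivAt
  rw [weighted_eq, hu.fderiv]
  specialize hb1 h
  specialize hb2 h
  change ‖zeta Θ‖ * |L1 h| ≤ |(-lam)| * ‖zeta Θ‖ ^ (-lam) * ‖zeta h‖ at hb1
  change ‖eta Θ‖ * |L2 h| ≤ |(-mu)| * ‖eta Θ‖ ^ (-mu) * ‖eta h‖ at hb2
  rw [abs_neg] at hb1 hb2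
  set a := ‖zeta Θ‖ ^ (-lam) with ha
  set b := ‖eta Θ‖ ^ (-mu) with hb
  have ha0 : 0 ≤ a := by positivity
  have hb0 : 0 ≤ b := by positivity
  have hK0 : 0 ≤ K := (norm_nonneg _).trans hvK
  have hζp : 0 < ‖zeta Θ‖ := norm_pos_iff.2 hΘ.1
  have hηp : 0 < ‖eta Θ‖ := norm_pos_iff.2 hΘ.2
  have h1 : t * |L1 h| ≤ |lam| * a := by
    rcases hζ with hζ | hζ
    · calc t * |L1 h| ≤ ‖zeta Θ‖ * |L1 h| := by gcongr
        _ ≤ |lam| * a * ‖zeta h‖ := hb1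
        _ ≤ |lam| * a * 1 := by gcongr; exact (norm_zeta_le h).trans hh
        _ = |lam| * a := mul_one _
    · rw [hζ, norm_zero, mul_zero] at hb1
      have : |L1 h| ≤ 0 := by by_contra hc; push Not at hc; nlinarith
      have h0 : |L1 h| = 0 := le_antisymm this (abs_nonneg _)
      rw [h0, mul_zero]; positivity
  have h2 : t * |L2 h| ≤ |mu| * b := by
    rcases hη with hη | hη
    · calc t * |L2 h| ≤ ‖eta Θ‖ * |L2 h| := by gcongr
        _ ≤ |mu| * b * ‖eta h‖ := hb2
        _ ≤ |mu| * b * 1 := by gcongr; exact (norm_eta_le h).trans hh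
        _ = |mu| * b := mul_one _
    · rw [hη, norm_zero, mul_zero] at hb2
      have : |L2 h| ≤ 0 := by by_contra hc; push Not at hc; nlinarith
      have h0 : |L2 h| = 0 := le_antisymm this (abs_nonneg _)
      rw [h0, mul_zero]; positivity
  have hdv : ‖fderiv ℝ v Θ h‖ ≤ K := by
    refine ((fderiv ℝ v Θ).le_of_opNorm_le hdK h).trans ?_
    nlinarith
  have hnorm : ‖(weight lam mu Θ • fderiv ℝ v Θ +
      ((‖(zetaL l n m) Θ‖ ^ (-lam)) • L2 + (‖(etaL l n m) Θ‖ ^ (-mu)) • L1).smulRight (v Θ)) h‖ ≤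
      a * b * K + (a * |L2 h| + b * |L1 h|) * K := by
    simp only [add_apply, smul_apply,
      ContinuousLinearMap.smulRight_apply]
    refine (norm_add_le _ _).trans (add_le_add ?_ ?_)
    · rw [norm_smul, Real.norm_of_nonneg (weight_nonneg _ _ _)]
      exact mul_le_mul_of_nonneg_left hdv (weight_nonneg lam mu Θ)
    · rw [norm_smul]
      refine mul_le_mul ?_ hvK (norm_nonneg _) (by positivity)
      refine (norm_add_le _ _).trans_eq ?_
      change ‖a • L2 h‖ + ‖b • L1 h‖ = _
      rw [norm_smul, norm_smul, Real.norm_of_nonneg ha0, Real.norm_of_nonneg hb0]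
      rfl
  refine (mul_le_mul_of_nonneg_left hnorm ht0).trans ?_
  change _ ≤ K * (1 + |lam| + |mu|) * (a * b)
  calc t * (a * b * K + (a * |L2 h| + b * |L1 h|) * K)
      = t * (a * b * K) + (a * (t * |L2 h|) + b * (t * |L1 h|)) * K := by ring
    _ ≤ 1 * (a * b * K) + (a * (|mu| * b) + b * (|lam| * a)) * K := by gcongr
    _ = K * (1 + |lam| + |mu|) * (a * b) := by ring

theorem mul_gradNorm_le {κ : Type} [Fintype κ] (e : κ → Idx l n m) (u : Amb l n m → ℂ)
    (Θ : Amb l n m) {t B : ℝ} (ht : 0 ≤ t) (hB : 0 ≤ B)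
    (h : ∀ k, ∀ c : ℂ, ‖c‖ = 1 → t * ‖fderiv ℝ u Θ (EuclideanSpace.single (e k) c)‖ ≤ B) :
    t * gradNorm e u Θ ≤ Real.sqrt (2 * Fintype.card κ) * B := by
  rw [gradNorm, ← Real.sqrt_sq ht, ← Real.sqrt_mul (sq_nonneg _),
    ← Real.sqrt_sq hB, ← Real.sqrt_mul (by positivity)]
  refine Real.sqrt_le_sqrt ?_
  rw [Finset.mul_sum]
  refine (Finset.sum_le_card_nsmul _ _ (2 * B ^ 2) fun k _ => ?_).trans_eq ?_
  · have h1 := pow_le_pow_left₀ (by positivity) (h k 1 (by simp)) 2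
    have h2 := pow_le_pow_left₀ (by positivity) (h k Complex.I (by simp)) 2
    rw [mul_pow] at h1 h2
    linarith
  · simp; ring

theorem gradNorm_nonneg {κ : Type} [Fintype κ] (e : κ → Idx l n m) (u : Amb l n m → ℂ)
    (Θ : Amb l n m) : 0 ≤ gradNorm e u Θ := Real.sqrt_nonneg _

theorem stokesIntegrand_nonneg (u : Amb l n m → ℂ) (Θ : Amb l n m) :
    0 ≤ stokesIntegrand u Θ := by
  have h1 : 0 ≤ gradXi u Θ := gradNorm_nonneg _ _ _
  have h2 : 0 ≤ gradZeta u Θ := gradNorm_nonneg _ _ _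
  have h3 : 0 ≤ gradEta u Θ := gradNorm_nonneg _ _ _
  unfold stokesIntegrand
  positivity

/-- The integrand is dominated by the weight, uniformly in functions `v` with given bounds on `v` and
its derivative. -/
theorem exists_stokesIntegrand_weighted_le (l n m : ℕ) (K lam mu : ℝ) (hK : 0 ≤ K) :
    ∃ B : ℝ, 0 ≤ B ∧ ∀ (v : Amb l n m → ℂ) (Θ : Amb l n m), Θ ∈ regularSet l n m → ‖Θ‖ ≤ 1 →
      DifferentiableAt ℝ v Θ → ‖v Θ‖ ≤ K → ‖fderiv ℝ v Θ‖ ≤ K →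
      stokesIntegrand (weighted v lam mu) Θ ≤ B * weight lam mu Θ := by
  set M := K * (1 + |lam| + |mu|) with hM
  have hM0 : 0 ≤ M := by positivity
  refine ⟨Real.sqrt (2 * Fintype.card (Fin l)) * M + Real.sqrt (2 * Fintype.card (Fin (n + 1))) * M
    + Real.sqrt (2 * Fintype.card (Fin (m + 1))) * M + K, by positivity, ?_⟩
  intro v Θ hΘ hΘ1 hv hvK hdK
  have hw := weight_nonneg lam mu Θ
  have hs : ∀ (i : Idx l n m) (c : ℂ), ‖c‖ = 1 → ‖(EuclideanSpace.single i c : Amb l n m)‖ ≤ 1 :=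
    fun i c hc => by simp [hc]
  have h1 : ‖xi Θ‖ * gradXi (weighted v lam mu) Θ ≤
      Real.sqrt (2 * Fintype.card (Fin l)) * (M * weight lam mu Θ) := by
    refine mul_gradNorm_le _ _ _ (norm_nonneg _) (by positivity) fun k c hc => ?_
    refine norm_fderiv_weighted_apply_le hΘ hv hvK hdK lam mu (norm_nonneg _)
      ((norm_xi_le Θ).trans hΘ1) (hs _ c hc) (.inr ?_) (.inr ?_)
    · ext i; simp [zeta]
    · ext i; simp [eta]
  have h2 : ‖zeta Θ‖ * gradZeta (weighted v lam mu) Θ ≤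
      Real.sqrt (2 * Fintype.card (Fin (n + 1))) * (M * weight lam mu Θ) := by
    refine mul_gradNorm_le _ _ _ (norm_nonneg _) (by positivity) fun k c hc => ?_
    refine norm_fderiv_weighted_apply_le hΘ hv hvK hdK lam mu (norm_nonneg _)
      ((norm_zeta_le Θ).trans hΘ1) (hs _ c hc) (.inl le_rfl) (.inr ?_)
    ext i; simp [eta]
  have h3 : ‖eta Θ‖ * gradEta (weighted v lam mu) Θ ≤
      Real.sqrt (2 * Fintype.card (Fin (m + 1))) * (M * weight lam mu Θ) := by
    refine mul_gradNorm_le _ _ _ (norm_nonneg _) (by positivity) fun k c hc => ?_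
    refine norm_fderiv_weighted_apply_le hΘ hv hvK hdK lam mu (norm_nonneg _)
      ((norm_eta_le Θ).trans hΘ1) (hs _ c hc) (.inr ?_) (.inl le_rfl)
    ext i; simp [zeta]
  have h4 : ‖weighted v lam mu Θ‖ ≤ K * weight lam mu Θ := by
    rw [norm_weighted, mul_comm]
    gcongr
  unfold stokesIntegrand
  linarith

/-- Cauchy-Schwarz in one block of complex coordinates. -/
theorem sum_norm_fderiv_single_le {κ : Type} [Fintype κ] (e : κ → Idx l n m) (u : Amb l n m → ℂ)
    (Θ : Amb l n m) (z : EuclideanSpace ℂ κ) :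
    ∑ k, ‖fderiv ℝ u Θ (EuclideanSpace.single (e k) (z k))‖ ≤ ‖z‖ * gradNorm e u Θ := by
  rw [EuclideanSpace.norm_eq, gradNorm]
  set q : κ → ℝ := fun k => Real.sqrt (‖fderiv ℝ u Θ (EuclideanSpace.single (e k) 1)‖ ^ 2 +
    ‖fderiv ℝ u Θ (EuclideanSpace.single (e k) Complex.I)‖ ^ 2) with hq
  have hqs : ∀ k, q k ^ 2 = ‖fderiv ℝ u Θ (EuclideanSpace.single (e k) 1)‖ ^ 2 +
      ‖fderiv ℝ u Θ (EuclideanSpace.single (e k) Complex.I)‖ ^ 2 :=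
    fun k => Real.sq_sqrt (by positivity)
  simp only [← hqs]
  refine le_trans (Finset.sum_le_sum fun k _ => ?_) (Real.sum_mul_le_sqrt_mul_sqrt _ _ _)
  have hsplit : (EuclideanSpace.single (e k) (z k) : Amb l n m) =
      (z k).re • EuclideanSpace.single (e k) 1 + (z k).im • EuclideanSpace.single (e k) Complex.I := by
    ext i
    rcases eq_or_ne i (e k) with rfl | hi
    · simp [Complex.re_add_im]
    · simp [hi]
  rw [hsplit, map_add, map_smul, map_smul]
  refine (norm_add_le _ _).trans ?_
  rw [norm_smul, norm_smul, Real.norm_eq_abs, Real.norm_eq_abs]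
  set x := ‖fderiv ℝ u Θ (EuclideanSpace.single (e k) 1)‖
  set y := ‖fderiv ℝ u Θ (EuclideanSpace.single (e k) Complex.I)‖
  refine abs_le_of_sq_le_sq' ?_ (by positivity) |>.2
  rw [mul_pow, hqs, Complex.sq_norm, Complex.normSq_apply, ← abs_mul_abs_self (z k).re,
    ← abs_mul_abs_self (z k).im]
  nlinarith [sq_nonneg (|(z k).re| * y - |(z k).im| * x)]

/-- The derivative of `u` at `Θ` along the radial direction `Θ` itself is controlled block by block. -/
theorem norm_fderiv_self_add_le (u : Amb l n m → ℂ) (Θ : Amb l n m) :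
    ‖fderiv ℝ u Θ Θ‖ + ‖u Θ‖ ≤ stokesIntegrand u Θ := by
  have hsum : Θ = ∑ i, EuclideanSpace.single i (Θ i) := by
    ext j
    rw [WithLp.ofLp_sum, Finset.sum_apply]
    simp
  have h : ‖fderiv ℝ u Θ Θ‖ ≤ ∑ i, ‖fderiv ℝ u Θ (EuclideanSpace.single i (Θ i))‖ := by
    conv_lhs => rw [show fderiv ℝ u Θ Θ = fderiv ℝ u Θ (∑ i, EuclideanSpace.single i (Θ i)) from
      congrArg _ hsum, map_sum]
    exact norm_sum_le _ _
  rw [Fintype.sum_sum_type, Fintype.sum_sum_type] at h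
  have h1 := sum_norm_fderiv_single_le (fun j : Fin l => (Sum.inl j : Idx l n m)) u Θ (xi Θ)
  have h2 := sum_norm_fderiv_single_le
    (fun j : Fin (n + 1) => (Sum.inr (Sum.inl j) : Idx l n m)) u Θ (zeta Θ)
  have h3 := sum_norm_fderiv_single_le
    (fun j : Fin (m + 1) => (Sum.inr (Sum.inr j) : Idx l n m)) u Θ (eta Θ)
  simp only [xi, zeta, eta] at h1 h2 h3
  simp only [stokesIntegrand, gradXi, gradZeta, gradEta, xi, zeta, eta]
  linarith

/-! ### The weighted function on `𝕄_N` -/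

theorem MN_subset_regularSet : MN l n m ⊆ regularSet l n m := fun _ h => ⟨h.1.1, h.1.2.1⟩

theorem bdMN_subset_regularSet : bdMN l n m ⊆ regularSet l n m := fun _ h => ⟨h.1.1, h.1.2.1⟩

theorem closure_MN_subset_closedBall : closure (MN l n m) ⊆ closedBall 0 1 :=
  closure_minimal (inter_subset_right.trans ball_subset_closedBall) isClosed_closedBall

theorem IsC1Closure.differentiableAt {v : Amb l n m → ℂ} (hv : IsC1Closure v) {Θ : Amb l n m}
    (hΘ : Θ ∈ MN l n m) : DifferentiableAt ℝ v Θ := by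
  obtain ⟨U, hU, hcU, hvU⟩ := hv
  refine (hvU.contDiffAt ?_).differentiableAt one_ne_zero
  exact inter_mem (hU.mem_nhds (hcU (subset_closure hΘ)))
    (mem_of_superset (isOpen_ball.mem_nhds hΘ.2) ball_subset_closedBall)

/-- `v` and its derivative are bounded on `𝕄_N`. Up to the sphere only the derivative within the
closed ball is continuous; it is well defined since the ball is convex with interior. -/
theorem IsC1Closure.exists_bound {v : Amb l n m → ℂ} (hv : IsC1Closure v) :
    ∃ K : ℝ, 0 ≤ K ∧ (∀ Θ ∈ closure (MN l n m), ‖v Θ‖ ≤ K) ∧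
      ∀ Θ ∈ MN l n m, ‖fderiv ℝ v Θ‖ ≤ K := by
  obtain ⟨U, hU, hcU, hvU⟩ := hv
  have hsub : closure (MN l n m) ⊆ U ∩ closedBall 0 1 :=
    subset_inter hcU closure_MN_subset_closedBall
  have hcomp : IsCompact (closure (MN l n m)) :=
    (isCompact_closedBall 0 1).of_isClosed_subset isClosed_closure closure_MN_subset_closedBall
  have huniq : UniqueDiffOn ℝ (U ∩ closedBall (0 : Amb l n m) 1) := by
    rw [inter_comm]
    refine (uniqueDiffOn_convex (convex_closedBall 0 1) ?_).inter hU
    exact ⟨0, ball_subset_interior_closedBall (mem_ball_self one_pos)⟩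
  obtain ⟨K1, hK1⟩ := hcomp.exists_bound_of_continuousOn (hvU.continuousOn.mono hsub)
  obtain ⟨K2, hK2⟩ := hcomp.exists_bound_of_continuousOn
    ((hvU.continuousOn_fderivWithin huniq le_rfl).mono hsub)
  refine ⟨max 0 (max K1 K2), le_max_left _ _,
    fun Θ h => (hK1 Θ h).trans ((le_max_left _ _).trans (le_max_right _ _)), fun Θ h => ?_⟩
  have hnhds : U ∩ closedBall 0 1 ∈ 𝓝 Θ := inter_mem (hU.mem_nhds (hcU (subset_closure h)))
    (mem_of_superset (isOpen_ball.mem_nhds h.2) ball_subset_closedBall)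
  rw [← fderivWithin_of_mem_nhds hnhds]
  exact (hK2 Θ (subset_closure h)).trans ((le_max_right _ _).trans (le_max_right _ _))

theorem IsC1Closure.continuousOn_weighted {v : Amb l n m → ℂ} (hv : IsC1Closure v) (lam mu : ℝ) :
    ContinuousOn (weighted v lam mu) (closure (MN l n m) ∩ regularSet l n m) := by
  obtain ⟨U, hU, hcU, hvU⟩ := hv
  rw [weighted_eq]
  exact ((contDiffOn_weight lam mu).continuousOn.mono inter_subset_right).smul
    (hvU.continuousOn.mono (inter_subset_left.trans
      (subset_inter hcU closure_MN_subset_closedBall)))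

theorem IsC1Closure.differentiableAt_weighted {v : Amb l n m → ℂ} (hv : IsC1Closure v)
    (lam mu : ℝ) {Θ : Amb l n m} (hΘ : Θ ∈ MN l n m) :
    DifferentiableAt ℝ (weighted v lam mu) Θ := by
  rw [weighted_eq]
  exact (((contDiffOn_weight lam mu).contDiffAt
    (isOpen_regularSet.mem_nhds (MN_subset_regularSet hΘ))).differentiableAt one_ne_zero).smul
    (hv.differentiableAt hΘ)

theorem measurable_gradNorm {κ : Type} [Fintype κ] (e : κ → Idx l n m) (u : Amb l n m → ℂ) :
    Measurable (gradNorm e u) := by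
  unfold gradNorm
  refine (Finset.measurable_sum _ fun k _ => ?_).sqrt
  exact ((measurable_fderiv_apply_const ℝ u _).norm.pow_const 2).add
    ((measurable_fderiv_apply_const ℝ u _).norm.pow_const 2)

theorem measurable_indicator_stokesIntegrand {u : Amb l n m → ℂ}
    (hu : ContinuousOn u (MN l n m)) : Measurable ((MN l n m).indicator (stokesIntegrand u)) := by
  classical
  have h1 : Measurable ((MN l n m).indicator fun Θ => ‖u Θ‖) := by
    rw [← piecewise_eq_indicator]
    exact hu.norm.measurable_piecewise continuousOn_const measurableSet_MN
  have h2 : Measurable fun Θ => ‖xi Θ‖ * gradXi u Θ + ‖zeta Θ‖ * gradZeta u Θ +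
      ‖eta Θ‖ * gradEta u Θ :=
    ((continuous_xi.norm.measurable.mul (measurable_gradNorm _ u)).add
      (continuous_zeta.norm.measurable.mul (measurable_gradNorm _ u))).add
      (continuous_eta.norm.measurable.mul (measurable_gradNorm _ u))
  exact (indicator_add (MN l n m) (fun Θ => ‖xi Θ‖ * gradXi u Θ + ‖zeta Θ‖ * gradZeta u Θ +
      ‖eta Θ‖ * gradEta u Θ) fun Θ => ‖u Θ‖) ▸ (h2.indicator measurableSet_MN).add h1

theorem weight_le_weight_max {lam mu : ℝ} {Θ : Amb l n m} (hΘ : Θ ∈ MN l n m) :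
    weight lam mu Θ ≤ ‖zeta Θ‖ ^ (-max lam 0) * ‖eta Θ‖ ^ (-max mu 0) := by
  have h1 : ‖Θ‖ ≤ 1 := (mem_ball_zero_iff.1 hΘ.2).le
  refine mul_le_mul ?_ ?_ (by positivity) (by positivity)
  · exact Real.rpow_le_rpow_of_exponent_ge (norm_pos_iff.2 hΘ.1.1) ((norm_zeta_le Θ).trans h1)
      (neg_le_neg (le_max_left _ _))
  · exact Real.rpow_le_rpow_of_exponent_ge (norm_pos_iff.2 hΘ.1.2.1) ((norm_eta_le Θ).trans h1)
      (neg_le_neg (le_max_left _ _))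

theorem lintegral_stokesIntegrand_lt_top (hn : 1 ≤ n) (hm : 1 ≤ m) {v : Amb l n m → ℂ}
    (hv : IsC1Closure v) {lam mu : ℝ} (hlam : lam < 2 * n) (hmu : mu < 2 * m) :
    ∫⁻ Θ in MN l n m, ENNReal.ofReal (stokesIntegrand (weighted v lam mu) Θ)
      ∂μH[((2 * (l + n + m) : ℕ) : ℝ)] < ∞ := by
  obtain ⟨K, hK0, hK1, hK2⟩ := hv.exists_bound
  obtain ⟨B, hB0, hB⟩ := exists_stokesIntegrand_weighted_le l n m K lam mu hK0
  have hn' : (0 : ℝ) < 2 * n := by positivity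
  have hm' : (0 : ℝ) < 2 * m := by positivity
  have hfin := lintegral_MN_rpow_lt_top (l := l) hn hm (le_max_right lam 0) (max_lt hlam hn')
    (le_max_right mu 0) (max_lt hmu hm')
  refine lt_of_le_of_lt ?_ (ENNReal.mul_lt_top (ENNReal.ofReal_lt_top (r := B)) hfin)
  rw [← lintegral_const_mul' _ _ ENNReal.ofReal_ne_top]
  refine setLIntegral_mono' measurableSet_MN fun Θ hΘ => ?_
  rw [← ENNReal.ofReal_mul hB0]
  refine ENNReal.ofReal_le_ofReal ((hB v Θ (MN_subset_regularSet hΘ)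
    (mem_ball_zero_iff.1 hΘ.2).le (hv.differentiableAt hΘ) (hK1 Θ (subset_closure hΘ))
    (hK2 Θ hΘ)).trans ?_)
  exact mul_le_mul_of_nonneg_left (weight_le_weight_max hΘ) hB0

theorem hausdorffMeasure_MN_lt_top (hn : 1 ≤ n) (hm : 1 ≤ m) :
    μH[((2 * (l + n + m) : ℕ) : ℝ)] (MN l n m) < ∞ := by
  have h := lintegral_MN_rpow_lt_top (l := l) (a := 0) (b := 0) hn hm le_rfl
    (by positivity) le_rfl (by positivity)
  simpa using h

/-! ### From the boundary to the interior -/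

theorem weight_smul (lam mu : ℝ) {r : ℝ} (hr : 0 < r) (Θ : Amb l n m) :
    weight lam mu (r • Θ) = r ^ (-lam - mu) * weight lam mu Θ := by
  rw [weight, weight, zeta_smul, eta_smul, norm_smul, norm_smul, Real.norm_of_nonneg hr.le,
    Real.mul_rpow hr.le (norm_nonneg _), Real.mul_rpow hr.le (norm_nonneg _), sub_eq_add_neg,
    Real.rpow_add hr]
  ring

/-- The value of `u` at a boundary point is controlled by the integral along its radius, by the
fundamental theorem of calculus for `r ↦ r ^ d u(r ω)`. -/
theorem enorm_weighted_le_radial {v : Amb l n m → ℂ} (hv : IsC1Closure v) {lam mu : ℝ} {d : ℕ}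
    (hd : 1 ≤ d) (hlm : lam + mu < d) {ω : Amb l n m} (hω : ω ∈ bdMN l n m) :
    ‖weighted v lam mu ω‖ₑ ≤ ∫⁻ r in Ioo (0 : ℝ) 1, ENNReal.ofReal (r ^ ((d - 1 : ℕ) : ℝ)) *
      ENNReal.ofReal (d * stokesIntegrand (weighted v lam mu) (r • ω)) := by
  set u := weighted v lam mu with hu
  set φ : ℝ → ℂ := fun r => r ^ d • u (r • ω) with hφ
  obtain ⟨K, hK0, hK1, -⟩ := hv.exists_bound
  have hmem : ∀ r ∈ Ioc (0 : ℝ) 1, r • ω ∈ closure (MN l n m) ∩ regularSet l n m := by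
    intro r hr
    rcases hr.2.eq_or_lt with rfl | h1
    · rw [one_smul]
      exact ⟨bdMN_subset_closure hω, bdMN_subset_regularSet hω⟩
    · have := smul_mem_MN ⟨hr.1, h1⟩ hω
      exact ⟨subset_closure this, MN_subset_regularSet this⟩
  have hC1 : ∀ ε ∈ Ioo (0 : ℝ) 1, ContDiffOn ℝ 1 φ (Icc ε 1) := by
    intro ε hε
    obtain ⟨U, hU, hcU, hvU⟩ := hv
    have hmaps : MapsTo (fun r : ℝ => r • ω) (Icc ε 1) (U ∩ closedBall 0 1 ∩ regularSet l n m) := by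
      intro r hr
      have := hmem r ⟨hε.1.trans_le hr.1, hr.2⟩
      exact ⟨⟨hcU this.1, closure_MN_subset_closedBall this.1⟩, this.2⟩
    have huC : ContDiffOn ℝ 1 u (U ∩ closedBall 0 1 ∩ regularSet l n m) := by
      rw [hu, weighted_eq]
      exact ((contDiffOn_weight lam mu).mono inter_subset_right).smul (hvU.mono inter_subset_left)
    have hray : ContDiffOn ℝ 1 (fun r : ℝ => r • ω) (Icc ε 1) :=
      (contDiff_id.smul contDiff_const).contDiffOn
    exact (contDiff_id.pow d).contDiffOn.smul (huC.comp hray hmaps)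
  have hderiv : ∀ r ∈ Ioo (0 : ℝ) 1, ‖deriv φ r‖ₑ ≤ ENNReal.ofReal (r ^ ((d - 1 : ℕ) : ℝ)) *
      ENNReal.ofReal (d * stokesIntegrand u (r • ω)) := by
    intro r hr
    have hdu := (hv.differentiableAt_weighted lam mu (smul_mem_MN hr hω)).hasFDerivAt
    have hray : HasDerivAt (fun r : ℝ => r • ω) ω r := by
      simpa using (hasDerivAt_id r).smul_const ω
    have hray' : HasDerivAt (fun r : ℝ => u (r • ω)) (fderiv ℝ u (r • ω) ω) r :=
      HasFDerivAt.comp_hasDerivAt (f := fun r : ℝ => r • ω) r hdu hray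
    have hD : HasDerivAt φ (r ^ d • fderiv ℝ u (r • ω) ω + ((d : ℝ) * r ^ (d - 1)) • u (r • ω)) r :=
      (hasDerivAt_pow d r).smul hray'
    have hr0 := hr.1
    have hd1 : (1 : ℝ) ≤ d := by exact_mod_cast hd
    rw [hD.deriv, ← ENNReal.ofReal_mul (by positivity), Real.rpow_natCast, ← ofReal_norm]
    refine ENNReal.ofReal_le_ofReal ?_
    -- One factor `r` turns the direction `ω` into the position vector `r • ω`.
    have hpow : r ^ d • fderiv ℝ u (r • ω) ω = r ^ (d - 1) • fderiv ℝ u (r • ω) (r • ω) := by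
      rw [map_smul, smul_smul, ← pow_succ, Nat.sub_add_cancel hd]
    have hS := norm_fderiv_self_add_le u (r • ω)
    rw [hpow]
    calc _ ≤ r ^ (d - 1) * ‖fderiv ℝ u (r • ω) (r • ω)‖ + (d * r ^ (d - 1)) * ‖u (r • ω)‖ := by
          refine (norm_add_le _ _).trans_eq ?_
          rw [norm_smul, norm_smul, Real.norm_of_nonneg (by positivity),
            Real.norm_of_nonneg (by positivity)]
      _ ≤ d * (r ^ (d - 1) * ‖fderiv ℝ u (r • ω) (r • ω)‖) + (d * r ^ (d - 1)) * ‖u (r • ω)‖ := by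
          gcongr ?_ + _
          exact le_mul_of_one_le_left (by positivity) hd1
      _ = r ^ (d - 1) * (d * (‖fderiv ℝ u (r • ω) (r • ω)‖ + ‖u (r • ω)‖)) := by ring
      _ ≤ _ := by gcongr
  set I := ∫⁻ r in Ioo (0 : ℝ) 1, ENNReal.ofReal (r ^ ((d - 1 : ℕ) : ℝ)) *
      ENNReal.ofReal (d * stokesIntegrand u (r • ω)) with hI
  have hstep : ∀ ε ∈ Ioo (0 : ℝ) 1, ‖u ω‖ₑ ≤ I + ‖φ ε‖ₑ := by
    intro ε hε
    have h1 : φ 1 = u ω := by simp [hφ]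
    have h2 : ‖φ 1 - φ ε‖ₑ ≤ I := by
      refine (enorm_sub_le_lintegral_deriv_of_contDiffOn_Icc (hC1 ε hε) hε.2.le).trans ?_
      rw [← restrict_Ioo_eq_restrict_Icc]
      refine (setLIntegral_mono' measurableSet_Ioo fun r hr =>
        hderiv r ⟨hε.1.trans hr.1, hr.2⟩).trans ?_
      exact lintegral_mono_set (Ioo_subset_Ioo_left hε.1.le)
    calc ‖u ω‖ₑ = ‖(φ 1 - φ ε) + φ ε‖ₑ := by rw [sub_add_cancel, h1]
      _ ≤ ‖φ 1 - φ ε‖ₑ + ‖φ ε‖ₑ := enorm_add_le _ _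
      _ ≤ I + ‖φ ε‖ₑ := by gcongr
  have hlim : Tendsto φ (𝓝[>] 0) (𝓝 0) := by
    have hp : Tendsto (fun r : ℝ => r ^ ((d : ℝ) - lam - mu) * (weight lam mu ω * K)) (𝓝[>] 0)
        (𝓝 0) := by
      have h0 : 0 < (d : ℝ) - lam - mu := by linarith
      have := (Real.continuousAt_rpow_const 0 ((d : ℝ) - lam - mu) (.inr h0.le)).tendsto
      rw [Real.zero_rpow h0.ne'] at this
      simpa using (this.mono_left nhdsWithin_le_nhds).mul_const (weight lam mu ω * K)
    refine squeeze_zero_norm' ?_ hp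
    filter_upwards [Ioo_mem_nhdsGT (show (0 : ℝ) < 1 by norm_num)] with r hr
    have hr0 := hr.1
    rw [hφ, hu]
    simp only
    rw [norm_smul, norm_weighted, weight_smul lam mu hr0, Real.norm_of_nonneg (by positivity)]
    have hvK := hK1 _ (hmem r ⟨hr.1, hr.2.le⟩).1
    have hw := weight_nonneg lam mu ω
    calc r ^ d * (r ^ (-lam - mu) * weight lam mu ω * ‖v (r • ω)‖)
        = (r ^ d * r ^ (-lam - mu)) * (weight lam mu ω * ‖v (r • ω)‖) := by ring
      _ ≤ (r ^ d * r ^ (-lam - mu)) * (weight lam mu ω * K) := by gcongr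
      _ = _ := by
        rw [← Real.rpow_natCast, ← Real.rpow_add hr0]
        congr 2
        ring
  have hlim2 : Tendsto (fun r => I + ‖φ r‖ₑ) (𝓝[>] 0) (𝓝 (I + 0)) := by
    refine tendsto_const_nhds.add ?_
    simpa using hlim.enorm
  rw [add_zero] at hlim2
  refine ge_of_tendsto hlim2 ?_
  filter_upwards [Ioo_mem_nhdsGT (show (0 : ℝ) < 1 by norm_num)] with r hr
  exact hstep r hr

/-- The asserted inequality, with `‖u‖` inside the boundary integral, for the unnormalised Hausdorff
measures. -/
theorem lintegral_bdMN_enorm_weighted_le (hn : 1 ≤ n) (hm : 1 ≤ m) {v : Amb l n m → ℂ}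
    (hv : IsC1Closure v) {lam mu : ℝ} (hlm : lam + mu < (2 * (l + n + m) : ℕ)) :
    ∫⁻ ω in bdMN l n m, ‖weighted v lam mu ω‖ₑ ∂μH[((2 * (l + n + m) - 1 : ℕ) : ℝ)] ≤
      (2 * (l + n + m) : ℕ) * ∫⁻ Θ in MN l n m,
        ENNReal.ofReal (stokesIntegrand (weighted v lam mu) Θ)
          ∂μH[((2 * (l + n + m) : ℕ) : ℝ)] := by
  set d : ℕ := 2 * (l + n + m) with hd
  have hd2 : 2 ≤ d := by omega
  have hs : (0 : ℝ) < ((d - 1 : ℕ) : ℝ) := by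
    exact_mod_cast (show 0 < d - 1 by omega)
  have hs1 : ((d - 1 : ℕ) : ℝ) + 1 = d := by exact_mod_cast (show d - 1 + 1 = d by omega)
  set u := weighted v lam mu with hu
  have hcont : ContinuousOn u (MN l n m) := (hv.continuousOn_weighted lam mu).mono
    (subset_inter subset_closure MN_subset_regularSet)
  -- The cut-off makes the integrand globally measurable without changing it on `𝕄_N`.
  set g : Amb l n m → ℝ≥0∞ := fun Θ =>
    ENNReal.ofReal (d * (MN l n m).indicator (stokesIntegrand u) Θ) with hg
  have hgm : Measurable g :=
    ((measurable_indicator_stokesIntegrand hcont).const_mul _).ennreal_ofReal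
  have hfin := hausdorffMeasure_MN_lt_top (l := l) hn hm
  rw [← hd, ← hs1] at hfin
  have hpolar := lintegral_link_radial_le (A := HN l n m) smul_mem_HN hs hfin hgm
  rw [hs1] at hpolar
  calc _ ≤ ∫⁻ ω in bdMN l n m, (∫⁻ r in Ioo (0 : ℝ) 1,
        ENNReal.ofReal (r ^ ((d - 1 : ℕ) : ℝ)) * g (r • ω)) ∂μH[((d - 1 : ℕ) : ℝ)] := by
        refine setLIntegral_mono' measurableSet_bdMN fun ω hω => ?_
        refine (enorm_weighted_le_radial hv (by omega) hlm hω).trans_eq ?_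
        refine setLIntegral_congr_fun measurableSet_Ioo fun r hr => ?_
        simp only [hg, indicator_of_mem (smul_mem_MN hr hω)]
        rfl
    _ ≤ ∫⁻ Θ in MN l n m, g Θ ∂μH[(d : ℝ)] := hpolar
    _ = ∫⁻ Θ in MN l n m, (d : ℝ≥0∞) * ENNReal.ofReal (stokesIntegrand u Θ) ∂μH[(d : ℝ)] := by
        refine setLIntegral_congr_fun measurableSet_MN fun Θ hΘ => ?_
        simp only [hg, indicator_of_mem hΘ]
        rw [ENNReal.ofReal_mul (Nat.cast_nonneg d), ENNReal.ofReal_natCast]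
    _ = _ := lintegral_const_mul' _ _ (ENNReal.natCast_ne_top d)

/-- The normalisation of the Euclidean Hausdorff measure is a positive finite constant. -/
theorem exists_euclideanHausdorffMeasure_eq_smul (X : Type*) [EMetricSpace X] [MeasurableSpace X]
    [BorelSpace X] (d : ℕ) :
    ∃ c : ℝ≥0, c ≠ 0 ∧ (Measure.euclideanHausdorffMeasure d : Measure X) = (c : ℝ≥0∞) • μH[d] :=
  ⟨_, Measure.addHaarScalarFactor_volume_hausdorffMeasure_ne_zero d, rfl⟩

end StokesType

open StokesType in
theorem theorem9p1 (l n m : ℕ) (hl : 1 ≤ l) (hn : 2 ≤ n) (hm : 2 ≤ m) :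
    ∃ C : ℝ, 0 < C ∧
      ∀ (v : StokesType.Amb l n m → ℂ) (lam mu : ℝ), StokesType.IsC1Closure v →
        lam < 2 * (n : ℝ) - 1 → mu < 2 * (m : ℝ) - 1 →
        MeasureTheory.IntegrableOn (StokesType.weighted v lam mu) (StokesType.bdMN l n m)
            (StokesType.surfMN l n m) ∧
        MeasureTheory.IntegrableOn
            (StokesType.stokesIntegrand (StokesType.weighted v lam mu)) (StokesType.MN l n m)
            (StokesType.volHN l n m) ∧
        ‖∫ Θ in StokesType.bdMN l n m, StokesType.weighted v lam mu Θ ∂(StokesType.surfMN l n m)‖ ≤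
          C * ∫ Θ in StokesType.MN l n m,
            StokesType.stokesIntegrand (StokesType.weighted v lam mu) Θ
              ∂(StokesType.volHN l n m) := by
  set d : ℕ := 2 * (l + n + m) with hd
  obtain ⟨c₁, hc₁, hμ₁⟩ := exists_euclideanHausdorffMeasure_eq_smul (Amb l n m) (d - 1)
  obtain ⟨c₂, hc₂, hμ₂⟩ := exists_euclideanHausdorffMeasure_eq_smul (Amb l n m) d
  have hsurf : (surfMN l n m).restrict (bdMN l n m) =
      (c₁ : ℝ≥0∞) • (μH[((d - 1 : ℕ) : ℝ)]).restrict (bdMN l n m) := by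
    rw [surfMN, Measure.restrict_restrict measurableSet_bdMN, inter_self, ← hd, hμ₁,
      Measure.restrict_smul]
  have hvol : (volHN l n m).restrict (MN l n m) =
      (c₂ : ℝ≥0∞) • (μH[(d : ℝ)]).restrict (MN l n m) := by
    rw [volHN, Measure.restrict_restrict measurableSet_MN,
      inter_eq_self_of_subset_left (show MN l n m ⊆ HN l n m from inter_subset_left), ← hd, hμ₂,
      Measure.restrict_smul]
  have hd0 : d ≠ 0 := by omega
  -- `d` is the homogeneity constant, `c₁ / c₂` compensates the normalisations of the two measures.
  refine ⟨c₁ / c₂ * d, by positivity, fun v lam mu hv hlam hmu => ?_⟩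
  set u := weighted v lam mu with hu
  have hcont := hv.continuousOn_weighted lam mu
  have hlm : lam + mu < (2 * (l + n + m) : ℕ) := by
    have : (0 : ℝ) ≤ l := Nat.cast_nonneg l
    push_cast
    linarith
  have hbd := lintegral_bdMN_enorm_weighted_le (by omega) (by omega) hv hlm
  rw [← hd, ← hu] at hbd
  have hJ := lintegral_stokesIntegrand_lt_top (l := l) (by omega) (by omega) hv
    (show lam < 2 * n by linarith) (show mu < 2 * m by linarith)
  rw [← hd, ← hu] at hJ
  set J := ∫⁻ Θ in MN l n m, ENNReal.ofReal (stokesIntegrand u Θ) ∂μH[(d : ℝ)] with hJdef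
  have hmeas : AEStronglyMeasurable (stokesIntegrand u) ((volHN l n m).restrict (MN l n m)) := by
    have h1 : Measurable ((MN l n m).indicator (stokesIntegrand u)) :=
      measurable_indicator_stokesIntegrand
        (hcont.mono (subset_inter subset_closure MN_subset_regularSet))
    exact (aestronglyMeasurable_indicator_iff measurableSet_MN).1 h1.aestronglyMeasurable
  have hvolJ : ∫⁻ Θ in MN l n m, ENNReal.ofReal (stokesIntegrand u Θ) ∂(volHN l n m) = c₂ * J := by
    rw [hvol, lintegral_smul_measure, smul_eq_mul]
  have hsurfJ : ∫⁻ Θ in bdMN l n m, ‖u Θ‖ₑ ∂(surfMN l n m) ≤ c₁ * (d * J) := by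
    rw [hsurf, lintegral_smul_measure, smul_eq_mul]
    gcongr
  have hfin : (c₁ : ℝ≥0∞) * (d * J) < ∞ := ENNReal.mul_lt_top ENNReal.coe_lt_top
    (ENNReal.mul_lt_top (ENNReal.natCast_lt_top d) hJ)
  refine ⟨⟨?_, hsurfJ.trans_lt hfin⟩, ⟨hmeas, ?_⟩, ?_⟩
  · exact (hcont.mono (subset_inter bdMN_subset_closure
      bdMN_subset_regularSet)).aestronglyMeasurable measurableSet_bdMN
  · rw [hasFiniteIntegral_iff_ofReal (.of_forall fun Θ => stokesIntegrand_nonneg u Θ), hvolJ]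
    exact ENNReal.mul_lt_top ENNReal.coe_lt_top hJ
  · rw [integral_eq_lintegral_of_nonneg_ae (.of_forall fun Θ => stokesIntegrand_nonneg u Θ) hmeas,
      hvolJ]
    have h1 := (enorm_integral_le_lintegral_enorm (μ := (surfMN l n m).restrict (bdMN l n m))
      u).trans hsurfJ
    have h2 := ENNReal.toReal_mono hfin.ne h1
    rw [toReal_enorm] at h2
    refine h2.trans_eq ?_
    have hc₂' : (c₂ : ℝ) ≠ 0 := by exact_mod_cast hc₂
    simp only [ENNReal.toReal_mul, ENNReal.coe_toReal, ENNReal.toReal_natCast]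
    field_simp
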